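/- Let $d\in\{2,3\}$, let $D\subset\mathbb{R}^d$ be a bounded open set and $\alpha>0$. Let $D_c=\{x\in D:\operatorname{dist}(x,\partial D)<\alpha\}$ and let $L^2_0(D;\mathbb{R}^d)$ be the space of $u\in L^2(D;\mathbb{R}^d)$ with $u=0$ a.e. on $D_c$; such $u$ are extended by zero outside $D$. Let $f:[0,\infty)\to\mathbb{R}$ be smooth and concave, with $f(0)=0$, $f(r)>0$ for $r>0$, $\lim_{r\to0^+}f(r)/r=f'(0)>0$ and $\lim_{r\to\infty}f(r)=f_\infty<\infty$. Let $J:[0,\infty)\to\mathbb{R}$ be measurable, with $0\le J<M$ on $[0,1)$ for some constant $M$, $J=0$ on $[1,\infty)$, and $\int_{|\xi|<1}|\xi|\,J(|\xi|)\,d\xi>0$. For $\epsilon>0$ set $$PD^\epsilon(u)=\int_D\frac{1}{\epsilon^d\omega_d}\int_{|y-x|<\epsilon}|y-x|\,\frac1\epsilon\,J\!\left(\frac{|y-x|}{\epsilon}\right)\frac{1}{|y-x|}\,f\!\left(|y-x|\,\mathcal{S}^2\right)dy\,dx,\qquad \mathcal{S}=\frac{u(y)-u(x)}{|y-x|}\cdot\frac{y-x}{|y-x|},$$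 where $\omega_d$ is the volume of the unit ball of $\mathbb{R}^d$. Theorem (Compactness). Let $\epsilon_k=1/k$ and $u^{\epsilon_k}\in L^2_0(D;\mathbb{R}^d)$, $k=1,2,\ldots$, be such that $$\sup_{k}\left(PD^{\epsilon_k}(u^{\epsilon_k})+\|u^{\epsilon_k}\|_{L^\infty(D;\mathbb{R}^d)}\right)<\infty.$$ Then there are a subsequence of $(u^{\epsilon_k})_k$ and a $u\in L^2_0(D;\mathbb{R}^d)$ such that the subsequence converges to $u$ strongly in $L^2(D;\mathbb{R}^d)$. -/

import Mathlib

open MeasureTheory Set Filter Topology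
open scoped ENNReal ContDiff

namespace CohesivePeridynamics

/-- The potential function `f : [0, ∞) → ℝ`: smooth, concave, positive (away from `f 0 = 0`), with
`lim_{r → 0+} f(r)/r = f'(0) > 0` and a finite limit at infinity.
Only the values of `f` on `[0, ∞)` matter. -/
structure IsCohesivePotential (f : ℝ → ℝ) : Prop where
  smooth : ContDiffOn ℝ ∞ f (Ici 0)
  concave : ConcaveOn ℝ (Ici 0) f
  zero : f 0 = 0
  pos : ∀ r, 0 < r → 0 < f r
  tendsto_zero : Tendsto (fun r => f r / r) (𝓝[>] 0) (𝓝 (derivWithin f (Ici 0) 0))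
  deriv_pos : 0 < derivWithin f (Ici 0) 0
  tendsto_atTop : ∃ fInf : ℝ, Tendsto f atTop (𝓝 fInf)

/-- The influence function `J` in dimension `d`: measurable, `0 ≤ J < M` on `[0, 1)`, `J = 0` on
`[1, ∞)`, and with positive normalization constant `m = ∫_{|ξ| < 1} |ξ| J(|ξ|) dξ`. -/
structure IsInfluenceFunction (d : ℕ) (J : ℝ → ℝ) : Prop where
  measurable : Measurable J
  bounded : ∃ M : ℝ, ∀ r, 0 ≤ r → r < 1 → 0 ≤ J r ∧ J r < M
  eq_zero : ∀ r, 1 ≤ r → J r = 0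
  normalization_pos :
    0 < ∫ ξ in Metric.ball (0 : EuclideanSpace ℝ (Fin d)) 1, ‖ξ‖ * J ‖ξ‖

variable {d : ℕ}

/-- The constraint set `D_c`: the boundary layer of `D` of thickness `α`. -/
def constraintSet (D : Set (EuclideanSpace ℝ (Fin d))) (α : ℝ) :
    Set (EuclideanSpace ℝ (Fin d)) :=
  {x | x ∈ D ∧ Metric.infDist x (frontier D) < α}

/-- The space `L²₀(D; ℝ^d)` of square integrable displacements on `D` that vanish (almost
everywhere) on the boundary layer `D_c`. -/
def L2Zero (D : Set (EuclideanSpace ℝ (Fin d))) (α : ℝ) :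
    Submodule ℝ (Lp (EuclideanSpace ℝ (Fin d)) 2 (volume.restrict D)) where
  carrier := {u | ∀ᵐ x ∂(volume.restrict D), x ∈ constraintSet D α → u x = 0}
  zero_mem' := by
    filter_upwards [Lp.coeFn_zero (EuclideanSpace ℝ (Fin d)) 2 (volume.restrict D)] with x hx _
    simpa using hx
  add_mem' := by
    intro u v hu hv
    filter_upwards [hu, hv, Lp.coeFn_add u v] with x h1 h2 h3 hx
    rw [h3, Pi.add_apply, h1 hx, h2 hx, add_zero]
  smul_mem' := by
    intro c u hu
    filter_upwards [hu, Lp.coeFn_smul c u] with x h1 h2 hx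
    rw [h2, Pi.smul_apply, h1 hx, smul_zero]

/-- The linearized strain `𝒮 = ((u(y) - u(x)) / |y - x|) · e`, with `e = (y - x) / |y - x|`. -/
noncomputable def strain (u : EuclideanSpace ℝ (Fin d) → EuclideanSpace ℝ (Fin d))
    (x y : EuclideanSpace ℝ (Fin d)) : ℝ :=
  inner ℝ (‖y - x‖⁻¹ • (u y - u x)) (‖y - x‖⁻¹ • (y - x))

/-- The potential per unit length
`(1/ε) J^ε(r) (1/r) f(r S²)`, where `r = |y - x|` and `J^ε(r) = J(r/ε)`. -/
noncomputable def potentialPerLength (J f : ℝ → ℝ) (ε S r : ℝ) : ℝ :=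
  1 / ε * J (r / ε) * (1 / r * f (r * S ^ 2))

/-- The nonlocal potential `W^ε(𝒮, y - x) = |y - x| 𝒲^ε(𝒮, y - x)`, as a function of `𝒮` and
`r = |y - x|`. -/
noncomputable def potential (J f : ℝ → ℝ) (ε S r : ℝ) : ℝ :=
  r * potentialPerLength J f ε S r

/-- The volume `V_d = ε^d ω_d` of the horizon. -/
noncomputable def horizonVolume (d : ℕ) (ε : ℝ) : ℝ :=
  ε ^ d * volume.real (Metric.ball (0 : EuclideanSpace ℝ (Fin d)) 1)

/-- The energy density `(1/V_d) ∫_{|y - x| < ε} W^ε(𝒮, y - x) dy` at `x`. Since the potential is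
nonnegative, it is an integral with values in `[0, ∞]`. -/
noncomputable def energyDensity (J f : ℝ → ℝ) (ε : ℝ)
    (u : EuclideanSpace ℝ (Fin d) → EuclideanSpace ℝ (Fin d)) (x : EuclideanSpace ℝ (Fin d)) :
    ℝ≥0∞ :=
  ENNReal.ofReal (1 / horizonVolume d ε) *
    ∫⁻ y in Metric.ball x ε, ENNReal.ofReal (potential J f ε (strain u x y) ‖y - x‖)

/-- The potential energy `PD^ε(u) = ∫_D (energy density) dx`. The horizon of a point near the
boundary leaves `D`: there the displacement is extended by zero. -/
noncomputable def PD (J f : ℝ → ℝ) (D : Set (EuclideanSpace ℝ (Fin d))) (ε : ℝ)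
    (u : EuclideanSpace ℝ (Fin d) → EuclideanSpace ℝ (Fin d)) : ℝ≥0∞ :=
  ∫⁻ x in D, energyDensity J f ε (D.indicator u) x

end CohesivePeridynamics

namespace CohesivePeridynamics

variable {d : ℕ}

/-! ### The potential and the influence function -/

/-! The energy is not coercive in any Sobolev norm, but with the uniform bound on `u` it controls
longitudinal differences in `L¹`. Concavity gives `f s ≥ f 1 * min s 1`, and a truncated square
dominates a bounded difference up to the length of the bond. Hence, with `μ = J(|ξ|) dξ`, the
variation `∫∫ |(u(x + εξ) - u(x)) · ξ| dx dμ` is at most `Cε` (`longitudinalVariation_le`).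

The variation at most doubles when the scale doubles. Along horizons `ε = 2⁻ⁿ` the bound therefore
passes to every fixed scale `h = 2⁻ᵐ`, uniformly in `n ≥ m` (`longitudinalVariation_half_pow_le`).

Strong compactness follows by comparing norms. Since `μ` is rotation invariant, `∫ (v · ξ)² dμ =
c|v|²` with `c > 0`. Let `A_h w (x) = ∫ (w(x + hξ) · ξ) ξ dμ`. Expanding the square, `∫∫ ((w(x + hξ)
- w(x)) · ξ)² = 2c‖w‖² - 2⟨w, A_h w⟩`. The left side is nonnegative and at most `2B` times the
variation, where `B` bounds `|w|`. Take a weak limit `v` of a subsequence. The form `⟨w, A_h w⟩` is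
continuous along it because `A_h` is smoothing, so `c‖u_n‖²` is eventually at most `⟨v, A_h v⟩` plus
a small error, and `⟨v, A_h v⟩ ≤ c‖v‖²`. Norms do not drop in the limit, and weak convergence
becomes strong (`tendsto_of_longitudinalVariation_le`). -/

theorem IsCohesivePotential.mul_min_le {f : ℝ → ℝ} (hf : IsCohesivePotential f) {s : ℝ}
    (hs : 0 ≤ s) : f 1 * min s 1 ≤ f s := by
  rcases le_total s 1 with h | h
  · rw [min_eq_left h]
    have := hf.concave.2 (show (1 : ℝ) ∈ Ici 0 by simp) (show (0 : ℝ) ∈ Ici 0 by simp) hs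
      (show (0 : ℝ) ≤ 1 - s by linarith) (by ring)
    simp only [smul_eq_mul, hf.zero] at this
    simp only [mul_one, mul_zero, add_zero] at this
    linarith
  · rw [min_eq_right h, mul_one]
    -- Concavity on `[1, t]` at the intermediate point `s`, with the nonnegative term in `f t`
    -- dropped; letting `t → ∞` gives `f 1 ≤ f s`.
    have key : ∀ t, s < t → (t - s) / (t - 1) * f 1 ≤ f s := by
      intro t ht
      have h1 : 0 < t - 1 := by linarith
      have := hf.concave.2 (show (1 : ℝ) ∈ Ici 0 by simp)
        (show t ∈ Ici 0 from (by linarith : (0 : ℝ) ≤ t))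
        (show 0 ≤ (t - s) / (t - 1) from div_nonneg (by linarith) h1.le)
        (show 0 ≤ (s - 1) / (t - 1) from div_nonneg (by linarith) h1.le)
        (by field_simp; ring)
      simp only [smul_eq_mul] at this
      have h2 : (t - s) / (t - 1) * 1 + (s - 1) / (t - 1) * t = s := by field_simp; ring
      rw [h2] at this
      have h3 : 0 ≤ (s - 1) / (t - 1) * f t :=
        mul_nonneg (div_nonneg (by linarith) h1.le) (hf.pos t (by linarith)).le
      linarith
    have lim : Tendsto (fun t : ℝ => (1 - (s - 1) * (t - 1)⁻¹) * f 1) atTop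
        (𝓝 ((1 - (s - 1) * 0) * f 1)) :=
      ((tendsto_const_nhds.sub (tendsto_const_nhds.mul
        (tendsto_inv_atTop_zero.comp (tendsto_atTop_add_const_right _ (-1) tendsto_id)))).mul
        tendsto_const_nhds)
    simp only [mul_zero, sub_zero, one_mul] at lim
    refine le_of_tendsto lim ?_
    filter_upwards [eventually_gt_atTop s] with t ht
    refine le_trans (le_of_eq ?_) (key t ht)
    have h1 : t - 1 ≠ 0 := by linarith
    field_simp
    ring

/-- Turns the truncated quadratic growth of the potential into linear growth, at the cost of an
error `r`. Below the truncation this is AM-GM, `a` being the geometric mean of `a ^ 2 / r` and `r`;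
above it, only `a ≤ b` is needed. -/
theorem le_add_one_mul_min_add {a b r : ℝ} (ha : 0 ≤ a) (hab : a ≤ b) (hr : 0 < r) :
    a ≤ (b + 1) * min (a ^ 2 / r) 1 + r := by
  rcases le_total (a ^ 2 / r) 1 with h | h
  · rw [min_eq_left h]
    have h1 : a ^ 2 = a ^ 2 / r * r := by field_simp
    have h0 : 0 ≤ a ^ 2 / r := by positivity
    have h2 : a ≤ a ^ 2 / r + r := by nlinarith [sq_nonneg (a ^ 2 / r - r), sq_nonneg a]
    nlinarith
  · rw [min_eq_right h]
    linarith

theorem IsInfluenceFunction.nonneg {J : ℝ → ℝ} (hJ : IsInfluenceFunction d J) {r : ℝ}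
    (hr : 0 ≤ r) : 0 ≤ J r := by
  obtain ⟨M, hM⟩ := hJ.bounded
  rcases lt_or_ge r 1 with h | h
  · exact (hM r hr h).1
  · rw [hJ.eq_zero r h]

theorem IsInfluenceFunction.exists_le {J : ℝ → ℝ} (hJ : IsInfluenceFunction d J) :
    ∃ M : ℝ, 0 ≤ M ∧ ∀ r, 0 ≤ r → J r ≤ M := by
  obtain ⟨M, hM⟩ := hJ.bounded
  have h0 := hM 0 le_rfl one_pos
  refine ⟨M, by linarith, fun r hr => ?_⟩
  rcases lt_or_ge r 1 with h | h
  · exact (hM r hr h).2.le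
  · rw [hJ.eq_zero r h]; linarith

/-- The measure `J(|ξ|) dξ`. -/
noncomputable def influenceMeasure (d : ℕ) (J : ℝ → ℝ) : Measure (EuclideanSpace ℝ (Fin d)) :=
  volume.withDensity fun ξ => ENNReal.ofReal (J ‖ξ‖)

theorem IsInfluenceFunction.measurable_density {J : ℝ → ℝ} (hJ : IsInfluenceFunction d J) :
    Measurable fun ξ : EuclideanSpace ℝ (Fin d) => ENNReal.ofReal (J ‖ξ‖) :=
  (hJ.measurable.comp measurable_norm).ennreal_ofReal

theorem IsInfluenceFunction.density_eq_indicator {J : ℝ → ℝ} (hJ : IsInfluenceFunction d J)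
    (ξ : EuclideanSpace ℝ (Fin d)) : ENNReal.ofReal (J ‖ξ‖)
      = (Metric.ball 0 1).indicator (fun ξ => ENNReal.ofReal (J ‖ξ‖)) ξ := by
  by_cases h : ξ ∈ Metric.ball (0 : EuclideanSpace ℝ (Fin d)) 1
  · rw [indicator_of_mem h]
  · rw [indicator_of_notMem h, hJ.eq_zero _ (by simpa using h), ENNReal.ofReal_zero]

theorem IsInfluenceFunction.isFiniteMeasure {J : ℝ → ℝ} (hJ : IsInfluenceFunction d J) :
    IsFiniteMeasure (influenceMeasure d J) := by
  obtain ⟨M, -, hM⟩ := hJ.exists_le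
  refine ⟨?_⟩
  rw [influenceMeasure, withDensity_apply _ MeasurableSet.univ, Measure.restrict_univ]
  calc ∫⁻ ξ : EuclideanSpace ℝ (Fin d), ENNReal.ofReal (J ‖ξ‖)
      = ∫⁻ ξ in Metric.ball (0 : EuclideanSpace ℝ (Fin d)) 1, ENNReal.ofReal (J ‖ξ‖) := by
        rw [← lintegral_indicator Metric.isOpen_ball.measurableSet]
        exact lintegral_congr hJ.density_eq_indicator
    _ ≤ ∫⁻ _ in Metric.ball (0 : EuclideanSpace ℝ (Fin d)) 1, ENNReal.ofReal M :=
        lintegral_mono fun ξ => ENNReal.ofReal_le_ofReal (hM _ (norm_nonneg _))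
    _ < ⊤ := by
        rw [setLIntegral_const]
        exact ENNReal.mul_lt_top ENNReal.ofReal_lt_top measure_ball_lt_top

theorem IsInfluenceFunction.ae_norm_le_one {J : ℝ → ℝ} (hJ : IsInfluenceFunction d J) :
    ∀ᵐ ξ ∂(influenceMeasure d J), ‖ξ‖ ≤ 1 := by
  rw [influenceMeasure, ae_withDensity_iff hJ.measurable_density]
  refine Eventually.of_forall fun ξ h => ?_
  by_contra hξ
  exact h (by rw [hJ.eq_zero _ (not_le.1 hξ).le, ENNReal.ofReal_zero])

/-! ### The nonlocal variation in longitudinal direction -/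

/-- The averaged `L¹` norm of the longitudinal differences of `u` at scale `h`. -/
noncomputable def longitudinalVariation (μ : Measure (EuclideanSpace ℝ (Fin d)))
    (u : EuclideanSpace ℝ (Fin d) → EuclideanSpace ℝ (Fin d)) (h : ℝ) : ℝ≥0∞ :=
  ∫⁻ ξ, ∫⁻ x, ‖(inner ℝ (u (x + h • ξ) - u x) ξ : ℝ)‖ₑ ∂volume ∂μ

/-- The step `2hξ` splits at `x + hξ` into two steps in the same direction `ξ`, so both are
longitudinal; translation invariance makes their integrals equal. -/
theorem longitudinalVariation_two_mul_le (μ : Measure (EuclideanSpace ℝ (Fin d)))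
    {u : EuclideanSpace ℝ (Fin d) → EuclideanSpace ℝ (Fin d)} (hu : Measurable u) (h : ℝ) :
    longitudinalVariation μ u (2 * h) ≤ 2 * longitudinalVariation μ u h := by
  unfold longitudinalVariation
  rw [← lintegral_const_mul' _ _ (by simp)]
  refine lintegral_mono fun ξ => ?_
  set g : EuclideanSpace ℝ (Fin d) → ℝ≥0∞ :=
    fun x => ‖(inner ℝ (u (x + h • ξ) - u x) ξ : ℝ)‖ₑ with hg
  have hgm : Measurable g := by
    refine Measurable.enorm (Measurable.inner ?_ measurable_const)
    exact (hu.comp (measurable_add_const _)).sub hu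
  calc ∫⁻ x, ‖(inner ℝ (u (x + (2 * h) • ξ) - u x) ξ : ℝ)‖ₑ
      ≤ ∫⁻ x, (g (x + h • ξ) + g x) := by
        refine lintegral_mono fun x => ?_
        have : u (x + (2 * h) • ξ) - u x
            = (u (x + h • ξ + h • ξ) - u (x + h • ξ)) + (u (x + h • ξ) - u x) := by
          rw [two_mul, add_smul, add_assoc]; abel
        rw [this, inner_add_left]
        exact enorm_add_le _ _
    _ = 2 * ∫⁻ x, g x := by
        rw [lintegral_add_right _ hgm, lintegral_add_right_eq_self g, two_mul]

theorem longitudinalVariation_two_pow_mul_le (μ : Measure (EuclideanSpace ℝ (Fin d)))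
    {u : EuclideanSpace ℝ (Fin d) → EuclideanSpace ℝ (Fin d)} (hu : Measurable u) (h : ℝ)
    (i : ℕ) : longitudinalVariation μ u (2 ^ i * h) ≤ 2 ^ i * longitudinalVariation μ u h := by
  induction i with
  | zero => simp
  | succ i ih =>
    calc longitudinalVariation μ u (2 ^ (i + 1) * h)
        = longitudinalVariation μ u (2 * (2 ^ i * h)) := by ring_nf
      _ ≤ 2 * longitudinalVariation μ u (2 ^ i * h) := longitudinalVariation_two_mul_le μ hu _
      _ ≤ 2 * (2 ^ i * longitudinalVariation μ u h) := by gcongr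
      _ = 2 ^ (i + 1) * longitudinalVariation μ u h := by ring

/-! ### The energy controls the longitudinal variation -/

theorem lintegral_ball_eq_lintegral_unit_ball {ε : ℝ} (hε : 0 < ε)
    (x : EuclideanSpace ℝ (Fin d)) (F : EuclideanSpace ℝ (Fin d) → ℝ≥0∞) :
    ∫⁻ y in Metric.ball x ε, F y
      = ENNReal.ofReal (ε ^ d) * ∫⁻ ξ in Metric.ball 0 1, F (x + ε • ξ) := by
  have e : MeasurableEmbedding fun ξ : EuclideanSpace ℝ (Fin d) => ε • ξ :=
    (Homeomorph.smulOfNeZero ε hε.ne').measurableEmbedding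
  have hmap : (volume : Measure (EuclideanSpace ℝ (Fin d)))
      = ENNReal.ofReal (ε ^ d) • Measure.map (fun ξ => ε • ξ) volume := by
    rw [Measure.map_addHaar_smul _ hε.ne', smul_smul, ← ENNReal.ofReal_mul (by positivity),
      finrank_euclideanSpace_fin, abs_of_pos (by positivity),
      mul_inv_cancel₀ (by positivity), ENNReal.ofReal_one, one_smul]
  calc ∫⁻ y in Metric.ball x ε, F y
      = ∫⁻ y, (Metric.ball x ε).indicator F y :=
        (lintegral_indicator Metric.isOpen_ball.measurableSet _).symm
    _ = ∫⁻ y, (Metric.ball x ε).indicator F (y + x) := (lintegral_add_right_eq_self _ x).symm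
    _ = ENNReal.ofReal (ε ^ d) * ∫⁻ ξ, (Metric.ball x ε).indicator F (ε • ξ + x) := by
        conv_lhs => rw [hmap]
        rw [lintegral_smul_measure, e.lintegral_map, smul_eq_mul]
    _ = ENNReal.ofReal (ε ^ d) * ∫⁻ ξ in Metric.ball 0 1, F (x + ε • ξ) := by
        rw [← lintegral_indicator Metric.isOpen_ball.measurableSet]
        congr 2
        ext ξ
        have : ε • ξ + x ∈ Metric.ball x ε ↔ ξ ∈ Metric.ball (0 : EuclideanSpace ℝ (Fin d)) 1 := by
          simp [dist_eq_norm, norm_smul, abs_of_pos hε, hε]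
        by_cases h : ξ ∈ Metric.ball (0 : EuclideanSpace ℝ (Fin d)) 1
        · rw [indicator_of_mem h, indicator_of_mem (this.2 h), add_comm]
        · rw [indicator_of_notMem h, indicator_of_notMem (mt this.1 h)]

/-- The volume of the unit ball, as a real number, is positive. -/
theorem volume_real_unit_ball_pos :
    0 < volume.real (Metric.ball (0 : EuclideanSpace ℝ (Fin d)) 1) :=
  ENNReal.toReal_pos (Metric.measure_ball_pos _ _ one_pos).ne' measure_ball_lt_top.ne

theorem lintegral_potential_eq (J f : ℝ → ℝ) {ε : ℝ} (hε : 0 < ε)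
    (u : EuclideanSpace ℝ (Fin d) → EuclideanSpace ℝ (Fin d)) (x : EuclideanSpace ℝ (Fin d)) :
    ∫⁻ ξ in Metric.ball 0 1,
        ENNReal.ofReal (potential J f ε (strain u x (x + ε • ξ)) ‖ε • ξ‖)
      = volume (Metric.ball (0 : EuclideanSpace ℝ (Fin d)) 1) * energyDensity J f ε u x := by
  have hω := volume_real_unit_ball_pos (d := d)
  have hω' : volume (Metric.ball (0 : EuclideanSpace ℝ (Fin d)) 1)
      = ENNReal.ofReal (volume.real (Metric.ball (0 : EuclideanSpace ℝ (Fin d)) 1)) :=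
    (ENNReal.ofReal_toReal measure_ball_lt_top.ne).symm
  rw [energyDensity, lintegral_ball_eq_lintegral_unit_ball hε, hω', ← mul_assoc, ← mul_assoc,
    ← ENNReal.ofReal_mul hω.le, ← ENNReal.ofReal_mul (by unfold horizonVolume; positivity),
    horizonVolume]
  have : volume.real (Metric.ball (0 : EuclideanSpace ℝ (Fin d)) 1)
      * (1 / (ε ^ d * volume.real (Metric.ball (0 : EuclideanSpace ℝ (Fin d)) 1))) * ε ^ d
      = 1 := by field_simp
  rw [this, ENNReal.ofReal_one, one_mul]
  simp

/-- With `r = ε‖ξ‖` and `a` the size of the difference along `ξ / ‖ξ‖`, the argument of `f` is `a ^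
2 / r`. The bound `a ≤ 2B` lets `le_add_one_mul_min_add` apply, and the leading `ε` undoes the `1 /
ε` in the potential. -/
theorem mul_abs_inner_le_potential {f J : ℝ → ℝ} (hf : IsCohesivePotential f)
    (hJ : IsInfluenceFunction d J) {B ε : ℝ} (hε : 0 < ε)
    {u : EuclideanSpace ℝ (Fin d) → EuclideanSpace ℝ (Fin d)} (hu : ∀ x, ‖u x‖ ≤ B)
    (x ξ : EuclideanSpace ℝ (Fin d)) (hξ : ‖ξ‖ < 1) :
    J ‖ξ‖ * |inner ℝ (u (x + ε • ξ) - u x) ξ|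
      ≤ ε * ((2 * B + 1) / f 1) * potential J f ε (strain u x (x + ε • ξ)) ‖ε • ξ‖
        + ε * J ‖ξ‖ := by
  have hJξ := hJ.nonneg (norm_nonneg ξ)
  rcases eq_or_ne ξ 0 with rfl | h0
  · simp [potential]
    simp at hJξ
    positivity
  have hn : 0 < ‖ξ‖ := norm_pos_iff.2 h0
  set w := u (x + ε • ξ) - u x with hw
  have hB : 0 ≤ B := (norm_nonneg _).trans (hu 0)
  have hwB : ‖w‖ ≤ 2 * B := by
    calc ‖w‖ ≤ ‖u (x + ε • ξ)‖ + ‖u x‖ := norm_sub_le _ _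
      _ ≤ 2 * B := by linarith [hu x, hu (x + ε • ξ)]
  set a : ℝ := |inner ℝ w ξ| / ‖ξ‖ with ha
  have haw : a ≤ 2 * B := by
    rw [ha, div_le_iff₀ hn]
    exact (abs_real_inner_le_norm w ξ).trans (by gcongr)
  have ha0 : 0 ≤ a := by positivity
  have hle : |inner ℝ w ξ| ≤ a := by
    rw [ha, le_div_iff₀ hn]
    exact mul_le_of_le_one_right (abs_nonneg _) hξ.le
  have hr : 0 < ε * ‖ξ‖ := by positivity
  have hS : ε * ‖ξ‖ * strain u x (x + ε • ξ) ^ 2 = a ^ 2 / (ε * ‖ξ‖) := by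
    rw [strain, add_sub_cancel_left, ← hw, inner_smul_left, inner_smul_right, inner_smul_right,
      norm_smul, Real.norm_of_nonneg hε.le, ha, div_pow, sq_abs]
    simp only [conj_trivial]
    field_simp
  have hpot : potential J f ε (strain u x (x + ε • ξ)) ‖ε • ξ‖
      = 1 / ε * J ‖ξ‖ * f (a ^ 2 / (ε * ‖ξ‖)) := by
    rw [potential, potentialPerLength, norm_smul, Real.norm_of_nonneg hε.le, hS,
      mul_div_cancel_left₀ _ hε.ne']
    field_simp
  have hf1 : 0 < f 1 := hf.pos 1 one_pos
  have hmin := hf.mul_min_le (show 0 ≤ a ^ 2 / (ε * ‖ξ‖) by positivity)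
  have h1 := le_add_one_mul_min_add ha0 haw hr
  have h2 : min (a ^ 2 / (ε * ‖ξ‖)) 1 ≤ f (a ^ 2 / (ε * ‖ξ‖)) / f 1 := by
    rw [le_div_iff₀ hf1]; linarith
  calc J ‖ξ‖ * |inner ℝ w ξ|
      ≤ J ‖ξ‖ * ((2 * B + 1) * (f (a ^ 2 / (ε * ‖ξ‖)) / f 1) + ε) := by
        refine mul_le_mul_of_nonneg_left ?_ hJξ
        have h3 : ε * ‖ξ‖ ≤ ε := mul_le_of_le_one_right hε.le hξ.le
        have h4 := mul_le_mul_of_nonneg_left h2 (show 0 ≤ 2 * B + 1 by positivity)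
        linarith
    _ = _ := by rw [hpot]; field_simp

/-- The variation integrates over all of space, the energy only over `D`. `hsupp` closes the gap:
from a point outside `D`, the whole horizon sees only zeros. -/
theorem longitudinalVariation_le {f J : ℝ → ℝ} (hf : IsCohesivePotential f)
    (hJ : IsInfluenceFunction d J) {D : Set (EuclideanSpace ℝ (Fin d))} (hD : MeasurableSet D)
    {B ε : ℝ} (hε : 0 < ε) {u : EuclideanSpace ℝ (Fin d) → EuclideanSpace ℝ (Fin d)}
    (hum : Measurable u) (hu : ∀ x, ‖u x‖ ≤ B)
    (hsupp : ∀ x, x ∉ D → ∀ y ∈ Metric.ball x ε, u y = 0) :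
    longitudinalVariation (influenceMeasure d J) u ε
      ≤ ENNReal.ofReal ε * (ENNReal.ofReal ((2 * B + 1) / f 1)
          * (volume (Metric.ball (0 : EuclideanSpace ℝ (Fin d)) 1) * PD J f D ε u)
          + influenceMeasure d J univ * volume D) := by
  have := hJ.isFiniteMeasure
  set μ := influenceMeasure d J with hμ
  have hB : 0 ≤ B := (norm_nonneg _).trans (hu 0)
  have hf1 : 0 < f 1 := hf.pos 1 one_pos
  have hmeas : Measurable fun p : EuclideanSpace ℝ (Fin d) × EuclideanSpace ℝ (Fin d) =>
      ‖(inner ℝ (u (p.2 + ε • p.1) - u p.2) p.1 : ℝ)‖ₑ := by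
    refine Measurable.enorm (Measurable.inner ?_ measurable_fst)
    exact (hum.comp (by fun_prop)).sub (hum.comp measurable_snd)
  have hind : D.indicator u = u := by
    refine indicator_eq_self.2 fun x hx => ?_
    by_contra h
    exact hx (hsupp x h x (Metric.mem_ball_self hε))
  set g : EuclideanSpace ℝ (Fin d) → ℝ≥0∞ :=
    fun x => ∫⁻ ξ, ‖(inner ℝ (u (x + ε • ξ) - u x) ξ : ℝ)‖ₑ ∂μ with hg
  have hg0 : ∀ x, x ∉ D → g x = 0 := by
    intro x hx
    rw [hg]
    refine (lintegral_congr_ae ?_).trans lintegral_zero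
    rw [hμ, influenceMeasure]
    rw [EventuallyEq, ae_withDensity_iff hJ.measurable_density]
    refine Eventually.of_forall fun ξ h => ?_
    have hξ : ‖ξ‖ < 1 := by
      by_contra hξ
      exact h (by rw [hJ.eq_zero _ (not_lt.1 hξ), ENNReal.ofReal_zero])
    rw [hsupp x hx x (Metric.mem_ball_self hε), hsupp x hx (x + ε • ξ) (by
      simpa [dist_eq_norm, norm_smul, abs_of_pos hε, hε] using hξ)]
    simp
  have hgle : ∀ x, g x ≤ ENNReal.ofReal (ε * ((2 * B + 1) / f 1))
      * (volume (Metric.ball (0 : EuclideanSpace ℝ (Fin d)) 1) * energyDensity J f ε u x)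
      + ENNReal.ofReal ε * μ univ := by
    intro x
    have hμu : μ univ = ∫⁻ ξ in Metric.ball (0 : EuclideanSpace ℝ (Fin d)) 1,
        ENNReal.ofReal (J ‖ξ‖) := by
      rw [hμ, influenceMeasure, withDensity_apply _ MeasurableSet.univ, Measure.restrict_univ,
        ← lintegral_indicator Metric.isOpen_ball.measurableSet]
      exact lintegral_congr hJ.density_eq_indicator
    rw [← lintegral_potential_eq J f hε, hμu, ← lintegral_const_mul' _ _ ENNReal.ofReal_ne_top,
      ← lintegral_const_mul' _ _ ENNReal.ofReal_ne_top,
      ← lintegral_add_right _ (hJ.measurable_density.const_mul _)]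
    have hgx : Measurable fun ξ => ‖(inner ℝ (u (x + ε • ξ) - u x) ξ : ℝ)‖ₑ :=
      Measurable.enorm (Measurable.inner ((hum.comp (by fun_prop)).sub measurable_const)
        measurable_id)
    rw [hg]
    simp only
    rw [hμ, influenceMeasure, lintegral_withDensity_eq_lintegral_mul _ hJ.measurable_density hgx,
      ← lintegral_indicator Metric.isOpen_ball.measurableSet]
    refine lintegral_mono fun ξ => ?_
    rw [Pi.mul_apply]
    by_cases h : ξ ∈ Metric.ball (0 : EuclideanSpace ℝ (Fin d)) 1
    · rw [indicator_of_mem h, ← ofReal_norm, Real.norm_eq_abs,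
        ← ENNReal.ofReal_mul (hJ.nonneg (norm_nonneg _)), ← ENNReal.ofReal_mul (by positivity),
        ← ENNReal.ofReal_mul hε.le]
      refine le_trans (ENNReal.ofReal_le_ofReal
        (mul_abs_inner_le_potential hf hJ hε hu x ξ (by simpa using h))) ENNReal.ofReal_add_le
    · rw [indicator_of_notMem h, hJ.density_eq_indicator, indicator_of_notMem h, zero_mul]
  calc longitudinalVariation μ u ε
      = ∫⁻ x, g x := by
        rw [longitudinalVariation]
        exact lintegral_lintegral_swap (f := fun ξ x =>
          ‖(inner ℝ (u (x + ε • ξ) - u x) ξ : ℝ)‖ₑ) hmeas.aemeasurable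
    _ = ∫⁻ x in D, g x := by
        rw [← lintegral_indicator hD]
        congr 1
        exact (indicator_eq_self.2 fun x hx => by by_contra h; exact hx (hg0 x h)).symm
    _ ≤ ∫⁻ x in D, (ENNReal.ofReal (ε * ((2 * B + 1) / f 1))
          * (volume (Metric.ball (0 : EuclideanSpace ℝ (Fin d)) 1) * energyDensity J f ε u x)
          + ENNReal.ofReal ε * μ univ) := lintegral_mono hgle
    _ = _ := by
        rw [lintegral_add_right _ measurable_const, lintegral_const_mul' _ _ ENNReal.ofReal_ne_top,
          lintegral_const_mul' _ _ measure_ball_lt_top.ne, setLIntegral_const, PD, hind,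
          ENNReal.ofReal_mul hε.le]
        ring

/-! ### The quadratic form of the influence measure -/

theorem IsInfluenceFunction.integral_influenceMeasure {J : ℝ → ℝ} (hJ : IsInfluenceFunction d J)
    (g : EuclideanSpace ℝ (Fin d) → ℝ) :
    ∫ ξ, g ξ ∂(influenceMeasure d J) = ∫ ξ, J ‖ξ‖ * g ξ := by
  rw [influenceMeasure, integral_withDensity_eq_integral_toReal_smul hJ.measurable_density
    (Eventually.of_forall fun _ => ENNReal.ofReal_lt_top)]
  refine integral_congr_ae (Eventually.of_forall fun ξ => ?_)
  simp [ENNReal.toReal_ofReal (hJ.nonneg (norm_nonneg ξ))]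

theorem IsInfluenceFunction.integrable_of_norm_le {J : ℝ → ℝ} (hJ : IsInfluenceFunction d J)
    {g : EuclideanSpace ℝ (Fin d) → ℝ} (hg : Measurable g) {C : ℝ}
    (hC : ∀ ξ, ‖ξ‖ ≤ 1 → |g ξ| ≤ C) : Integrable g (influenceMeasure d J) := by
  have := hJ.isFiniteMeasure
  refine Integrable.of_bound hg.aestronglyMeasurable C ?_
  filter_upwards [hJ.ae_norm_le_one] with ξ hξ using hC ξ hξ

/-- If the second moment vanished, then `J ‖ξ‖ = 0` or `ξ = 0` almost everywhere, which would make
the normalization integral zero. -/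
theorem IsInfluenceFunction.integral_norm_sq_pos {J : ℝ → ℝ} (hJ : IsInfluenceFunction d J) :
    0 < ∫ ξ, ‖ξ‖ ^ 2 ∂(influenceMeasure d J) := by
  have hint : Integrable (fun ξ : EuclideanSpace ℝ (Fin d) => ‖ξ‖ ^ 2) (influenceMeasure d J) :=
    hJ.integrable_of_norm_le (by fun_prop) (C := 1) fun ξ hξ => by
      rw [abs_of_nonneg (by positivity)]
      exact pow_le_one₀ (norm_nonneg _) hξ
  refine lt_of_le_of_ne (integral_nonneg fun ξ => by positivity) fun h => ?_
  rw [eq_comm, integral_eq_zero_iff_of_nonneg (fun ξ => by positivity) hint, EventuallyEq,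
    influenceMeasure, ae_withDensity_iff hJ.measurable_density] at h
  refine hJ.normalization_pos.ne' (integral_eq_zero_of_ae (ae_restrict_of_ae ?_))
  filter_upwards [h] with ξ hξ
  by_cases h0 : J ‖ξ‖ = 0
  · simp [h0]
  · have h1 := hξ (by
      have := lt_of_le_of_ne (hJ.nonneg (norm_nonneg ξ)) (Ne.symm h0)
      simpa using this)
    have h2 : ‖ξ‖ = 0 := by simpa using h1
    simp [h2]

/-- The reflection in the hyperplane orthogonal to `v - w` sends `v` to `w` and preserves both
Lebesgue measure and the radial weight. -/
theorem IsInfluenceFunction.integral_inner_sq_eq_of_norm_eq {J : ℝ → ℝ}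
    (hJ : IsInfluenceFunction d J) {v w : EuclideanSpace ℝ (Fin d)} (h : ‖v‖ = ‖w‖) :
    ∫ ξ, (inner ℝ v ξ) ^ 2 ∂(influenceMeasure d J)
      = ∫ ξ, (inner ℝ w ξ) ^ 2 ∂(influenceMeasure d J) := by
  rw [hJ.integral_influenceMeasure, hJ.integral_influenceMeasure]
  set R := (ℝ ∙ (v - w))ᗮ.reflection with hR
  have hRv : R v = w := Submodule.reflection_sub h
  rw [← (LinearIsometryEquiv.measurePreserving R).integral_comp
    R.toHomeomorph.measurableEmbedding (fun ξ => J ‖ξ‖ * (inner ℝ w ξ) ^ 2)]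
  refine integral_congr_ae (Eventually.of_forall fun ξ => ?_)
  simp only
  rw [← hRv, LinearIsometryEquiv.inner_map_map, LinearIsometryEquiv.norm_map]

/-- The quadratic form `v ↦ ∫ (v · ξ)² J(|ξ|) dξ` is a positive multiple of `|v|²`. -/
theorem IsInfluenceFunction.exists_integral_inner_sq_eq {J : ℝ → ℝ}
    (hJ : IsInfluenceFunction d J) : ∃ c : ℝ, 0 < c ∧ ∀ v : EuclideanSpace ℝ (Fin d),
      ∫ ξ, (inner ℝ v ξ) ^ 2 ∂(influenceMeasure d J) = c * ‖v‖ ^ 2 := by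
  have hpos := hJ.integral_norm_sq_pos
  have hd : 0 < (d : ℝ) := by
    rcases Nat.eq_zero_or_pos d with rfl | h
    · exfalso
      refine hpos.ne' (integral_eq_zero_of_ae (Eventually.of_forall fun ξ => ?_))
      simp [Subsingleton.elim ξ 0]
    · exact_mod_cast h
  -- The constant is the trace divided by `d`: all basis directions contribute equally, and their
  -- sum is the second moment.
  refine ⟨(∫ ξ, ‖ξ‖ ^ 2 ∂(influenceMeasure d J)) / d, by positivity, fun v => ?_⟩
  let b := EuclideanSpace.basisFun (Fin d) ℝ
  have h1 : ∀ i, ∫ ξ, (inner ℝ v ξ) ^ 2 ∂(influenceMeasure d J)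
      = ‖v‖ ^ 2 * ∫ ξ, (inner ℝ (b i) ξ) ^ 2 ∂(influenceMeasure d J) := by
    intro i
    rw [hJ.integral_inner_sq_eq_of_norm_eq (w := ‖v‖ • b i) (by simp [norm_smul]),
      ← integral_const_mul]
    refine integral_congr_ae (Eventually.of_forall fun ξ => ?_)
    simp [inner_smul_left, mul_pow]
  have h2 : ∑ i, ∫ ξ, (inner ℝ (b i) ξ) ^ 2 ∂(influenceMeasure d J)
      = ∫ ξ, ‖ξ‖ ^ 2 ∂(influenceMeasure d J) := by
    rw [← integral_finsetSum]
    · refine integral_congr_ae (Eventually.of_forall fun ξ => ?_)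
      exact b.sum_sq_inner_right ξ
    · intro i _
      refine hJ.integrable_of_norm_le (by fun_prop) (C := 1) fun ξ hξ => ?_
      rw [abs_of_nonneg (by positivity), ← sq_abs]
      refine pow_le_one₀ (abs_nonneg _) ((abs_real_inner_le_norm _ _).trans ?_)
      rw [b.norm_eq_one, one_mul]
      exact hξ
  have h3 : (d : ℝ) * ∫ ξ, (inner ℝ v ξ) ^ 2 ∂(influenceMeasure d J)
      = ‖v‖ ^ 2 * ∫ ξ, ‖ξ‖ ^ 2 ∂(influenceMeasure d J) := by
    rw [← h2, Finset.mul_sum, ← Finset.sum_congr rfl fun i _ => h1 i]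
    simp
  field_simp
  linarith

/-! ### The longitudinal average -/

/-- The longitudinal average `∫ (w(x + h ξ) · ξ) ξ dμ(ξ)`. -/
noncomputable def longitudinalAverage (μ : Measure (EuclideanSpace ℝ (Fin d))) (h : ℝ)
    (w : EuclideanSpace ℝ (Fin d) → EuclideanSpace ℝ (Fin d)) (x : EuclideanSpace ℝ (Fin d)) :
    EuclideanSpace ℝ (Fin d) :=
  ∫ ξ, (inner ℝ (w (x + h • ξ)) ξ : ℝ) • ξ ∂μ

theorem memLp_two_comp_add_smul {w : EuclideanSpace ℝ (Fin d) → EuclideanSpace ℝ (Fin d)}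
    (hw : MemLp w 2 volume) {h : ℝ} (hh : h ≠ 0) (x : EuclideanSpace ℝ (Fin d)) :
    MemLp (fun ξ => w (x + h • ξ)) 2 volume := by
  have h1 : MemLp (fun y => w (x + y)) 2 volume :=
    hw.comp_measurePreserving (measurePreserving_add_left volume x)
  have e : MeasurableEmbedding fun ξ : EuclideanSpace ℝ (Fin d) => h • ξ :=
    (Homeomorph.smulOfNeZero h hh).measurableEmbedding
  refine (e.memLp_map_measure_iff (g := fun y => w (x + y))).1 ?_
  rw [Measure.map_addHaar_smul _ hh]
  exact h1.smul_measure ENNReal.ofReal_ne_top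

theorem IsInfluenceFunction.influenceMeasure_le {J : ℝ → ℝ} {M : ℝ}
    (hM : ∀ r, 0 ≤ r → J r ≤ M) :
    influenceMeasure d J ≤ ENNReal.ofReal M • volume := by
  rw [influenceMeasure, ← withDensity_const]
  exact withDensity_mono (Eventually.of_forall fun ξ =>
    ENNReal.ofReal_le_ofReal (hM _ (norm_nonneg _)))

theorem IsInfluenceFunction.integrable_inner_smul {J : ℝ → ℝ} (hJ : IsInfluenceFunction d J)
    {w : EuclideanSpace ℝ (Fin d) → EuclideanSpace ℝ (Fin d)}
    (hw : MemLp w 2 volume) {h : ℝ} (hh : h ≠ 0) (x : EuclideanSpace ℝ (Fin d)) :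
    Integrable (fun ξ => (inner ℝ (w (x + h • ξ)) ξ : ℝ) • ξ) (influenceMeasure d J) := by
  have := hJ.isFiniteMeasure
  obtain ⟨M, -, hM⟩ := hJ.exists_le
  have h1 : MemLp (fun ξ => w (x + h • ξ)) 2 (influenceMeasure d J) :=
    (memLp_two_comp_add_smul hw hh x).of_measure_le_smul ENNReal.ofReal_ne_top
      (IsInfluenceFunction.influenceMeasure_le hM)
  have h2 : Integrable (fun ξ => w (x + h • ξ)) (influenceMeasure d J) :=
    h1.integrable (by norm_num)
  refine h2.norm.mono' ?_ ?_
  · have hid : AEStronglyMeasurable (fun ξ : EuclideanSpace ℝ (Fin d) => ξ)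
        (influenceMeasure d J) := measurable_id.aestronglyMeasurable
    have hin : AEStronglyMeasurable (fun ξ => (inner ℝ (w (x + h • ξ)) ξ : ℝ))
        (influenceMeasure d J) := h2.aestronglyMeasurable.inner hid
    exact hin.smul hid
  · filter_upwards [hJ.ae_norm_le_one] with ξ hξ
    rw [norm_smul, Real.norm_eq_abs]
    calc |inner ℝ (w (x + h • ξ)) ξ| * ‖ξ‖ ≤ (‖w (x + h • ξ)‖ * ‖ξ‖) * ‖ξ‖ := by
          gcongr; exact abs_real_inner_le_norm _ _
      _ ≤ (‖w (x + h • ξ)‖ * 1) * 1 := by gcongr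
      _ = ‖w (x + h • ξ)‖ := by ring

theorem IsInfluenceFunction.inner_longitudinalAverage {J : ℝ → ℝ} (hJ : IsInfluenceFunction d J)
    {w : EuclideanSpace ℝ (Fin d) → EuclideanSpace ℝ (Fin d)}
    (hw : MemLp w 2 volume) {h : ℝ} (hh : h ≠ 0) (x e : EuclideanSpace ℝ (Fin d)) :
    inner ℝ e (longitudinalAverage (influenceMeasure d J) h w x)
      = ∫ ξ, inner ℝ e ξ * inner ℝ (w (x + h • ξ)) ξ ∂(influenceMeasure d J) := by
  rw [longitudinalAverage, ← integral_inner (hJ.integrable_inner_smul hw hh x)]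
  refine integral_congr_ae (Eventually.of_forall fun ξ => ?_)
  simp [inner_smul_right, mul_comm]

/-- The kernel representing the component along `e` of the longitudinal average at `x`. -/
noncomputable def averageKernel (J : ℝ → ℝ) (h : ℝ) (x e y : EuclideanSpace ℝ (Fin d)) :
    EuclideanSpace ℝ (Fin d) :=
  (|(h ^ d)⁻¹| * J ‖h⁻¹ • (y - x)‖ * inner ℝ e (h⁻¹ • (y - x)) : ℝ) • (h⁻¹ • (y - x))

theorem IsInfluenceFunction.measurable_averageKernel {J : ℝ → ℝ} (hJ : IsInfluenceFunction d J)
    (h : ℝ) (x e : EuclideanSpace ℝ (Fin d)) : Measurable (averageKernel J h x e) := by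
  unfold averageKernel
  have : Measurable fun y : EuclideanSpace ℝ (Fin d) => J ‖h⁻¹ • (y - x)‖ :=
    hJ.measurable.comp (by fun_prop)
  have h2 : Measurable fun y : EuclideanSpace ℝ (Fin d) => h⁻¹ • (y - x) := by fun_prop
  exact ((measurable_const.mul this).mul (measurable_const.inner h2)).smul h2

theorem IsInfluenceFunction.exists_norm_averageKernel_le {J : ℝ → ℝ}
    (hJ : IsInfluenceFunction d J) (h : ℝ) : ∃ C : ℝ, 0 ≤ C ∧
      ∀ x e y : EuclideanSpace ℝ (Fin d), ‖averageKernel J h x e y‖ ≤ C * ‖e‖ := by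
  obtain ⟨M, hM0, hM⟩ := hJ.exists_le
  refine ⟨|(h ^ d)⁻¹| * M, by positivity, fun x e y => ?_⟩
  rw [averageKernel]
  set ξ := h⁻¹ • (y - x)
  have hJ0 := hJ.nonneg (norm_nonneg ξ)
  rcases lt_or_ge ‖ξ‖ 1 with h1 | h1
  · rw [norm_smul, norm_mul, norm_mul, Real.norm_eq_abs, abs_abs, Real.norm_of_nonneg hJ0]
    calc |(h ^ d)⁻¹| * J ‖ξ‖ * ‖inner ℝ e ξ‖ * ‖ξ‖
        ≤ |(h ^ d)⁻¹| * M * (‖e‖ * 1) * 1 := by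
          have : ‖inner ℝ e ξ‖ ≤ ‖e‖ * 1 :=
            (norm_inner_le_norm e ξ).trans (by gcongr)
          gcongr
          exact hM _ (norm_nonneg _)
      _ = _ := by ring
  · rw [hJ.eq_zero _ h1]
    simp
    positivity

/-- The substitution `y = x + hξ` writes each component of the average as a pairing of `w` with a
bounded kernel, so weak convergence of `w` gives pointwise convergence of the average. -/
theorem IsInfluenceFunction.inner_longitudinalAverage_eq_integral_kernel {J : ℝ → ℝ}
    (hJ : IsInfluenceFunction d J) {w : EuclideanSpace ℝ (Fin d) → EuclideanSpace ℝ (Fin d)}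
    (hw : MemLp w 2 volume) {h : ℝ} (hh : h ≠ 0) (x e : EuclideanSpace ℝ (Fin d)) :
    inner ℝ e (longitudinalAverage (influenceMeasure d J) h w x)
      = ∫ y, inner ℝ (averageKernel J h x e y) (w y) := by
  rw [hJ.inner_longitudinalAverage hw hh, hJ.integral_influenceMeasure]
  set F : EuclideanSpace ℝ (Fin d) → ℝ := fun z =>
    J ‖h⁻¹ • z‖ * (inner ℝ e (h⁻¹ • z) * inner ℝ (w (x + z)) (h⁻¹ • z)) with hF
  calc ∫ ξ, J ‖ξ‖ * (inner ℝ e ξ * inner ℝ (w (x + h • ξ)) ξ)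
      = ∫ ξ, F (h • ξ) := by
        refine integral_congr_ae (Eventually.of_forall fun ξ => ?_)
        simp only [hF]
        rw [inv_smul_smul₀ hh]
    _ = |(h ^ d)⁻¹| * ∫ z, F z := by
        rw [Measure.integral_comp_smul, finrank_euclideanSpace_fin, smul_eq_mul]
    _ = |(h ^ d)⁻¹| * ∫ y, F (y - x) := by rw [integral_sub_right_eq_self]
    _ = ∫ y, inner ℝ (averageKernel J h x e y) (w y) := by
        rw [← integral_const_mul]
        refine integral_congr_ae (Eventually.of_forall fun y => ?_)
        simp only [hF, averageKernel, add_sub_cancel]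
        simp only [inner_smul_left, inner_smul_right, conj_trivial]
        rw [real_inner_comm (w y)]
        ring

/-! ### Square integrable longitudinal differences -/

section Prod

variable {μ : Measure (EuclideanSpace ℝ (Fin d))} [IsFiniteMeasure μ]
  {w : EuclideanSpace ℝ (Fin d) → EuclideanSpace ℝ (Fin d)}

theorem memLp_two_inner_prod (hμ : ∀ᵐ ξ ∂μ, ‖ξ‖ ≤ 1) (hw : MemLp w 2 volume) :
    MemLp (fun p : EuclideanSpace ℝ (Fin d) × EuclideanSpace ℝ (Fin d) =>
      (inner ℝ (w p.2) p.1 : ℝ)) 2 (μ.prod volume) := by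
  have h1 : MemLp (fun p : EuclideanSpace ℝ (Fin d) × EuclideanSpace ℝ (Fin d) => w p.2) 2
    (μ.prod volume) := hw.comp_snd μ
  refine h1.mono (h1.aestronglyMeasurable.inner measurable_fst.aestronglyMeasurable) ?_
  filter_upwards [Measure.quasiMeasurePreserving_fst.ae hμ] with p hp
  exact (norm_inner_le_norm _ _).trans (mul_le_of_le_one_right (norm_nonneg _) hp)

/-- Lets the shifted and unshifted longitudinal components be compared on the product space,
although the shift depends on `ξ`. -/
theorem measurePreserving_shear (h : ℝ) :
    MeasurePreserving (fun p : EuclideanSpace ℝ (Fin d) × EuclideanSpace ℝ (Fin d) =>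
      (p.1, p.2 + h • p.1)) (μ.prod volume) (μ.prod volume) :=
  (MeasurePreserving.id μ).skew_product (μc := volume) (μd := volume)
    (g := fun ξ x => x + h • ξ)
    (show Measurable fun p : EuclideanSpace ℝ (Fin d) × EuclideanSpace ℝ (Fin d) =>
      p.2 + h • p.1 by fun_prop)
    (Eventually.of_forall fun ξ => (measurePreserving_add_right volume (h • ξ)).map_eq)

theorem memLp_two_inner_prod_shear (hμ : ∀ᵐ ξ ∂μ, ‖ξ‖ ≤ 1) (hw : MemLp w 2 volume) (h : ℝ) :
    MemLp (fun p : EuclideanSpace ℝ (Fin d) × EuclideanSpace ℝ (Fin d) =>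
      (inner ℝ (w (p.2 + h • p.1)) p.1 : ℝ)) 2 (μ.prod volume) := by
  have h1 := (memLp_two_inner_prod hμ hw).comp_measurePreserving (measurePreserving_shear h)
  exact h1

end Prod

/-- The averaged squared `L²` norm of the longitudinal differences, expanded. -/
theorem IsInfluenceFunction.integral_sq_longitudinal_difference {J : ℝ → ℝ}
    (hJ : IsInfluenceFunction d J) {c : ℝ} (hc : ∀ v : EuclideanSpace ℝ (Fin d),
      ∫ ξ, (inner ℝ v ξ) ^ 2 ∂(influenceMeasure d J) = c * ‖v‖ ^ 2)
    {w : EuclideanSpace ℝ (Fin d) → EuclideanSpace ℝ (Fin d)}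
    (hw : MemLp w 2 volume) {h : ℝ} (hh : h ≠ 0) :
    ∫ p, (inner ℝ (w (p.2 + h • p.1) - w p.2) p.1 : ℝ) ^ 2 ∂((influenceMeasure d J).prod volume)
      = 2 * (c * ∫ x, ‖w x‖ ^ 2)
        - 2 * ∫ x, inner ℝ (w x) (longitudinalAverage (influenceMeasure d J) h w x) := by
  have := hJ.isFiniteMeasure
  set μ := influenceMeasure d J with hμ
  have ha := memLp_two_inner_prod hJ.ae_norm_le_one hw
  have hb := memLp_two_inner_prod_shear hJ.ae_norm_le_one hw h
  have hab := hb.integrable_mul ha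
  have ha2 := ha.integrable_sq
  have hb2 := hb.integrable_sq
  have e1 : ∫ p, (inner ℝ (w p.2) p.1 : ℝ) ^ 2 ∂(μ.prod volume) = c * ∫ x, ‖w x‖ ^ 2 := by
    rw [integral_prod_symm _ ha2, ← integral_const_mul]
    exact integral_congr_ae (Eventually.of_forall fun x => hc (w x))
  have e2 : ∫ p, (inner ℝ (w (p.2 + h • p.1)) p.1 : ℝ) ^ 2 ∂(μ.prod volume)
      = ∫ p, (inner ℝ (w p.2) p.1 : ℝ) ^ 2 ∂(μ.prod volume) := by
    have hs := measurePreserving_shear (μ := μ) h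
    conv_rhs => rw [← hs.map_eq]
    rw [integral_map hs.measurable.aemeasurable]
    rw [hs.map_eq]
    exact ha2.aestronglyMeasurable
  have e3 : ∫ p, (inner ℝ (w (p.2 + h • p.1)) p.1 : ℝ) * inner ℝ (w p.2) p.1 ∂(μ.prod volume)
      = ∫ x, inner ℝ (w x) (longitudinalAverage μ h w x) := by
    refine (integral_prod_symm _ hab).trans ?_
    refine integral_congr_ae (Eventually.of_forall fun x => ?_)
    simp only [Pi.mul_apply]
    rw [hJ.inner_longitudinalAverage hw hh]
    refine integral_congr_ae (Eventually.of_forall fun ξ => ?_)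
    simp only [mul_comm]
  have e4 : ∀ p : EuclideanSpace ℝ (Fin d) × EuclideanSpace ℝ (Fin d),
      (inner ℝ (w (p.2 + h • p.1) - w p.2) p.1 : ℝ) ^ 2
      = ((inner ℝ (w (p.2 + h • p.1)) p.1 : ℝ) ^ 2 + (inner ℝ (w p.2) p.1 : ℝ) ^ 2)
        - 2 * ((inner ℝ (w (p.2 + h • p.1)) p.1 : ℝ) * inner ℝ (w p.2) p.1) := by
    intro p
    rw [inner_sub_left]
    ring
  have e5 := integral_sub (hb2.add ha2) (Integrable.const_mul hab 2)
  simp only [Pi.add_apply, Pi.mul_apply] at e5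
  rw [integral_congr_ae (Eventually.of_forall e4), e5, integral_add hb2 ha2,
    integral_const_mul, e2, e1, e3]
  ring

theorem IsInfluenceFunction.integral_inner_longitudinalAverage_le {J : ℝ → ℝ}
    (hJ : IsInfluenceFunction d J) {c : ℝ} (hc : ∀ v : EuclideanSpace ℝ (Fin d),
      ∫ ξ, (inner ℝ v ξ) ^ 2 ∂(influenceMeasure d J) = c * ‖v‖ ^ 2)
    {w : EuclideanSpace ℝ (Fin d) → EuclideanSpace ℝ (Fin d)}
    (hw : MemLp w 2 volume) {h : ℝ} (hh : h ≠ 0) :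
    ∫ x, inner ℝ (w x) (longitudinalAverage (influenceMeasure d J) h w x)
      ≤ c * ∫ x, ‖w x‖ ^ 2 := by
  have h1 := hJ.integral_sq_longitudinal_difference hc hw hh
  have h2 : 0 ≤ ∫ p, (inner ℝ (w (p.2 + h • p.1) - w p.2) p.1 : ℝ) ^ 2
    ∂((influenceMeasure d J).prod volume) := integral_nonneg fun p => sq_nonneg _
  linarith

/-- In the expanded square one factor is at most `2B`, since `‖ξ‖ ≤ 1` for `μ`-almost every `ξ`; the
other factor integrates to the variation. -/
theorem IsInfluenceFunction.mul_integral_norm_sq_le {J : ℝ → ℝ}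
    (hJ : IsInfluenceFunction d J) {c : ℝ} (hc : ∀ v : EuclideanSpace ℝ (Fin d),
      ∫ ξ, (inner ℝ v ξ) ^ 2 ∂(influenceMeasure d J) = c * ‖v‖ ^ 2)
    {w : EuclideanSpace ℝ (Fin d) → EuclideanSpace ℝ (Fin d)} (hwm : Measurable w)
    (hw : MemLp w 2 volume) {B : ℝ} (hB : ∀ x, ‖w x‖ ≤ B) {h : ℝ} (hh : h ≠ 0)
    (hfin : longitudinalVariation (influenceMeasure d J) w h ≠ ⊤) :
    c * ∫ x, ‖w x‖ ^ 2
      ≤ (∫ x, inner ℝ (w x) (longitudinalAverage (influenceMeasure d J) h w x))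
        + B * (longitudinalVariation (influenceMeasure d J) w h).toReal := by
  have := hJ.isFiniteMeasure
  have h1 := hJ.integral_sq_longitudinal_difference hc hw hh
  set μ := influenceMeasure d J with hμ
  have hB0 : 0 ≤ B := (norm_nonneg _).trans (hB 0)
  have hm : Measurable fun p : EuclideanSpace ℝ (Fin d) × EuclideanSpace ℝ (Fin d) =>
      (inner ℝ (w (p.2 + h • p.1) - w p.2) p.1 : ℝ) :=
    Measurable.inner ((hwm.comp (by fun_prop)).sub (hwm.comp measurable_snd)) measurable_fst
  have h2 : ∫ p, (inner ℝ (w (p.2 + h • p.1) - w p.2) p.1 : ℝ) ^ 2 ∂(μ.prod volume)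
      ≤ 2 * B * (longitudinalVariation μ w h).toReal := by
    have hV : longitudinalVariation μ w h = ∫⁻ p,
        ‖(inner ℝ (w (p.2 + h • p.1) - w p.2) p.1 : ℝ)‖ₑ ∂(μ.prod volume) :=
      (lintegral_prod (fun p : EuclideanSpace ℝ (Fin d) × EuclideanSpace ℝ (Fin d) =>
        ‖(inner ℝ (w (p.2 + h • p.1) - w p.2) p.1 : ℝ)‖ₑ) hm.enorm.aemeasurable).symm
    rw [integral_eq_lintegral_of_nonneg_ae (Eventually.of_forall fun p => sq_nonneg _)
      (hm.pow_const 2).aestronglyMeasurable, ← ENNReal.toReal_ofReal (by positivity : 0 ≤ 2 * B),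
      ← ENNReal.toReal_mul]
    refine ENNReal.toReal_mono (ENNReal.mul_ne_top ENNReal.ofReal_ne_top hfin) ?_
    rw [hV, ← lintegral_const_mul' _ _ ENNReal.ofReal_ne_top]
    refine lintegral_mono_ae ?_
    filter_upwards [Measure.quasiMeasurePreserving_fst.ae hJ.ae_norm_le_one] with p hp
    rw [← ofReal_norm, ← ENNReal.ofReal_mul (by positivity)]
    refine ENNReal.ofReal_le_ofReal ?_
    rw [← sq_abs, sq, Real.norm_eq_abs]
    refine mul_le_mul_of_nonneg_right ?_ (abs_nonneg _)
    calc |inner ℝ (w (p.2 + h • p.1) - w p.2) p.1|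
        ≤ ‖w (p.2 + h • p.1) - w p.2‖ * ‖p.1‖ := abs_real_inner_le_norm _ _
      _ ≤ (B + B) * 1 := by
          gcongr
          exact (norm_sub_le _ _).trans (add_le_add (hB _) (hB _))
      _ = 2 * B := by ring
  rw [h1] at h2
  linarith

/-! ### Weak convergence in Hilbert spaces -/

section Hilbert

variable {H : Type*} [NormedAddCommGroup H] [InnerProductSpace ℝ H]

/-- Sequential Banach-Alaoglu in the dual, carried back by the Riesz isometry. -/
theorem exists_subseq_tendsto_inner [CompleteSpace H] [TopologicalSpace.SeparableSpace H]
    {u : ℕ → H} {R : ℝ} (hu : ∀ n, ‖u n‖ ≤ R) :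
    ∃ φ : ℕ → ℕ, StrictMono φ ∧ ∃ v : H, ∀ g : H,
      Tendsto (fun n => inner ℝ g (u (φ n))) atTop (𝓝 (inner ℝ g v)) := by
  have hc := WeakDual.isSeqCompact_closedBall ℝ H 0 R
  have hmem : ∀ n, StrongDual.toWeakDual (InnerProductSpace.toDual ℝ H (u n))
      ∈ WeakDual.toStrongDual ⁻¹' Metric.closedBall (0 : StrongDual ℝ H) R := by
    intro n
    rw [mem_preimage, mem_closedBall_zero_iff]
    refine le_trans (le_of_eq ?_) (hu n)
    exact (InnerProductSpace.toDual ℝ H).norm_map (u n)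
  obtain ⟨a, -, φ, hφ, ha⟩ := hc hmem
  refine ⟨φ, hφ, (InnerProductSpace.toDual ℝ H).symm (WeakDual.toStrongDual a), fun g => ?_⟩
  have h1 := ((WeakDual.eval_continuous g).tendsto a).comp ha
  have h2 : inner ℝ g ((InnerProductSpace.toDual ℝ H).symm (WeakDual.toStrongDual a)) = a g := by
    rw [real_inner_comm, InnerProductSpace.toDual_symm_apply]
    rfl
  rw [h2]
  refine h1.congr fun n => ?_
  rw [real_inner_comm]
  rfl

theorem tendsto_of_tendsto_inner_of_norm_sq_le {u : ℕ → H} {v : H}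
    (hw : ∀ g : H, Tendsto (fun n => inner ℝ g (u n)) atTop (𝓝 (inner ℝ g v)))
    (hn : ∀ η > 0, ∀ᶠ n in atTop, ‖u n‖ ^ 2 ≤ ‖v‖ ^ 2 + η) :
    Tendsto u atTop (𝓝 v) := by
  rw [Metric.tendsto_nhds]
  intro δ hδ
  -- Expanding `‖u n - v‖ ^ 2`, the two errors contribute `δ ^ 2 / 4` and `2 * (δ ^ 2 / 4)`, in
  -- total less than `δ ^ 2`.
  have h1 := (hw v).eventually (lt_mem_nhds (show inner ℝ v v - δ ^ 2 / 4 < inner ℝ v v by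
    have : 0 < δ ^ 2 := by positivity
    linarith))
  filter_upwards [h1, hn (δ ^ 2 / 4) (by positivity)] with n hn1 hn2
  rw [dist_eq_norm]
  refine lt_of_pow_lt_pow_left₀ 2 hδ.le ?_
  rw [norm_sub_sq_real, real_inner_comm]
  rw [real_inner_self_eq_norm_sq] at hn1
  have : 0 < δ ^ 2 := by positivity
  linarith

end Hilbert

/-! ### Continuity of the longitudinal average under weak convergence -/

theorem longitudinalAverage_stronglyMeasurable {μ : Measure (EuclideanSpace ℝ (Fin d))}
    [SFinite μ] (h : ℝ) {w : EuclideanSpace ℝ (Fin d) → EuclideanSpace ℝ (Fin d)}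
    (hw : Measurable w) : StronglyMeasurable (longitudinalAverage μ h w) := by
  have h1 : Measurable fun p : EuclideanSpace ℝ (Fin d) × EuclideanSpace ℝ (Fin d) =>
      (inner ℝ (w (p.1 + h • p.2)) p.2 : ℝ) :=
    Measurable.inner (hw.comp (by fun_prop)) measurable_snd
  have h2 : Measurable fun p : EuclideanSpace ℝ (Fin d) × EuclideanSpace ℝ (Fin d) =>
      (inner ℝ (w (p.1 + h • p.2)) p.2 : ℝ) • p.2 := h1.smul measurable_snd
  exact h2.stronglyMeasurable.integral_prod_right

theorem integral_eq_setIntegral_of_eq_zero {D : Set (EuclideanSpace ℝ (Fin d))}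
    {w : EuclideanSpace ℝ (Fin d) → EuclideanSpace ℝ (Fin d)} (hw : ∀ x, x ∉ D → w x = 0)
    (F : EuclideanSpace ℝ (Fin d) → EuclideanSpace ℝ (Fin d) → ℝ) (hF : ∀ x, F x 0 = 0) :
    ∫ x, F x (w x) = ∫ x in D, F x (w x) :=
  (setIntegral_eq_integral_of_forall_compl_eq_zero fun x hx => by rw [hw x hx, hF]).symm

theorem memLp_two_of_ae_eq {D : Set (EuclideanSpace ℝ (Fin d))} (hD : MeasurableSet D)
    {w : EuclideanSpace ℝ (Fin d) → EuclideanSpace ℝ (Fin d)} (hw : ∀ x, x ∉ D → w x = 0)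
    {v : Lp (EuclideanSpace ℝ (Fin d)) 2 (volume.restrict D)}
    (hv : v =ᵐ[volume.restrict D] w) : MemLp w 2 volume := by
  have h1 : MemLp w 2 (volume.restrict D) := (memLp_congr_ae hv).1 (Lp.memLp v)
  rw [← indicator_eq_self.2 (fun x hx => by by_contra h; exact hx (hw x h) :
    Function.support w ⊆ D)]
  exact (memLp_indicator_iff_restrict hD).2 h1

theorem integral_norm_sq_eq {D : Set (EuclideanSpace ℝ (Fin d))}
    {w : EuclideanSpace ℝ (Fin d) → EuclideanSpace ℝ (Fin d)} (hw : ∀ x, x ∉ D → w x = 0)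
    {v : Lp (EuclideanSpace ℝ (Fin d)) 2 (volume.restrict D)}
    (hv : v =ᵐ[volume.restrict D] w) : ∫ x, ‖w x‖ ^ 2 = ‖v‖ ^ 2 := by
  rw [integral_eq_setIntegral_of_eq_zero hw (fun _ z => ‖z‖ ^ 2) (by simp),
    ← real_inner_self_eq_norm_sq, L2.inner_def]
  refine integral_congr_ae ?_
  filter_upwards [hv] with x hx
  rw [real_inner_self_eq_norm_sq, hx]

section Weak

variable {J : ℝ → ℝ} {D : Set (EuclideanSpace ℝ (Fin d))} {B : ℝ}
  {U : ℕ → EuclideanSpace ℝ (Fin d) → EuclideanSpace ℝ (Fin d)}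
  {V : EuclideanSpace ℝ (Fin d) → EuclideanSpace ℝ (Fin d)}
  {u : ℕ → Lp (EuclideanSpace ℝ (Fin d)) 2 (volume.restrict D)}
  {v : Lp (EuclideanSpace ℝ (Fin d)) 2 (volume.restrict D)}

theorem tendsto_setIntegral_inner
    (huU : ∀ n, u n =ᵐ[volume.restrict D] U n) (hvV : v =ᵐ[volume.restrict D] V)
    (hweak : ∀ g, Tendsto (fun n => inner ℝ g (u n)) atTop (𝓝 (inner ℝ g v)))
    {g : EuclideanSpace ℝ (Fin d) → EuclideanSpace ℝ (Fin d)}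
    (hg : MemLp g 2 (volume.restrict D)) :
    Tendsto (fun n => ∫ x in D, inner ℝ (g x) (U n x)) atTop
      (𝓝 (∫ x in D, inner ℝ (g x) (V x))) := by
  have key : ∀ (w : Lp (EuclideanSpace ℝ (Fin d)) 2 (volume.restrict D))
      (W : EuclideanSpace ℝ (Fin d) → EuclideanSpace ℝ (Fin d)), w =ᵐ[volume.restrict D] W →
      inner ℝ (hg.toLp g) w = ∫ x in D, inner ℝ (g x) (W x) := by
    intro w W hwW
    rw [L2.inner_def]
    refine integral_congr_ae ?_
    filter_upwards [hwW, hg.coeFn_toLp] with x h1 h2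
    rw [h1, h2]
  rw [← key v V hvV]
  exact (hweak _).congr fun n => key _ _ (huU n)

theorem IsInfluenceFunction.tendsto_longitudinalAverage (hJ : IsInfluenceFunction d J)
    (hD : MeasurableSet D) (hDfin : volume D ≠ ⊤)
    (huU : ∀ n, u n =ᵐ[volume.restrict D] U n) (hvV : v =ᵐ[volume.restrict D] V)
    (hU0 : ∀ n x, x ∉ D → U n x = 0) (hV0 : ∀ x, x ∉ D → V x = 0)
    (hweak : ∀ g, Tendsto (fun n => inner ℝ g (u n)) atTop (𝓝 (inner ℝ g v)))
    {h : ℝ} (hh : h ≠ 0) (x : EuclideanSpace ℝ (Fin d)) :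
    Tendsto (fun n => longitudinalAverage (influenceMeasure d J) h (U n) x) atTop
      (𝓝 (longitudinalAverage (influenceMeasure d J) h V x)) := by
  have : IsFiniteMeasure (volume.restrict D) := ⟨by simpa using hDfin.lt_top⟩
  obtain ⟨C, hC0, hC⟩ := hJ.exists_norm_averageKernel_le h
  have key : ∀ e : EuclideanSpace ℝ (Fin d), Tendsto
      (fun n => inner ℝ e (longitudinalAverage (influenceMeasure d J) h (U n) x)) atTop
      (𝓝 (inner ℝ e (longitudinalAverage (influenceMeasure d J) h V x))) := by
    intro e
    have hκ : MemLp (averageKernel J h x e) 2 (volume.restrict D) :=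
      MemLp.of_bound (hJ.measurable_averageKernel h x e).aestronglyMeasurable (C * ‖e‖)
        (Eventually.of_forall (hC x e))
    have h1 := tendsto_setIntegral_inner huU hvV hweak hκ
    rw [← integral_eq_setIntegral_of_eq_zero hV0
      (fun y z => inner ℝ (averageKernel J h x e y) z) (by simp),
      ← hJ.inner_longitudinalAverage_eq_integral_kernel (memLp_two_of_ae_eq hD hV0 hvV) hh] at h1
    refine h1.congr fun n => ?_
    rw [← integral_eq_setIntegral_of_eq_zero (hU0 n)
      (fun y z => inner ℝ (averageKernel J h x e y) z) (by simp),
      ← hJ.inner_longitudinalAverage_eq_integral_kernel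
        (memLp_two_of_ae_eq hD (hU0 n) (huU n)) hh]
  let b := EuclideanSpace.basisFun (Fin d) ℝ
  have h2 := tendsto_finsetSum (Finset.univ : Finset (Fin d)) fun i _ =>
    (key (b i)).smul_const (b i)
  simpa only [b.sum_repr'] using h2

theorem IsInfluenceFunction.exists_norm_longitudinalAverage_le (hJ : IsInfluenceFunction d J)
    (hDfin : volume D ≠ ⊤) (B : ℝ) {h : ℝ} (hh : h ≠ 0) :
    ∃ C : ℝ, ∀ w : EuclideanSpace ℝ (Fin d) → EuclideanSpace ℝ (Fin d),
      MemLp w 2 volume → (∀ x, x ∉ D → w x = 0) → (∀ x, ‖w x‖ ≤ B) →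
        ∀ x, ‖longitudinalAverage (influenceMeasure d J) h w x‖ ≤ C := by
  obtain ⟨C, hC0, hC⟩ := hJ.exists_norm_averageKernel_le h
  refine ⟨C * B * volume.real D, fun w hw hw0 hwB x => ?_⟩
  have hB : 0 ≤ B := (norm_nonneg _).trans (hwB 0)
  set z := longitudinalAverage (influenceMeasure d J) h w x with hz
  rcases eq_or_ne z 0 with h0 | h0
  · rw [h0, norm_zero]
    positivity
  have hzpos : 0 < ‖z‖ := norm_pos_iff.2 h0
  -- The average is tested against its own value `z`; the kernel bound is linear in `‖z‖`, so one
  -- factor cancels.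
  have h1 : ‖z‖ ^ 2 = ∫ y in D, inner ℝ (averageKernel J h x z y) (w y) := by
    rw [← real_inner_self_eq_norm_sq, ← integral_eq_setIntegral_of_eq_zero hw0
      (fun y e => inner ℝ (averageKernel J h x z y) e) (by simp),
      ← hJ.inner_longitudinalAverage_eq_integral_kernel hw hh]
  have h2 : ‖∫ y in D, inner ℝ (averageKernel J h x z y) (w y)‖
      ≤ (C * ‖z‖ * B) * volume.real D := by
    refine norm_setIntegral_le_of_norm_le_const hDfin.lt_top fun y _ => ?_
    refine (norm_inner_le_norm _ _).trans ?_
    have := hC x z y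
    have := hwB y
    gcongr
  rw [← h1, norm_pow, norm_norm] at h2
  nlinarith

/-- Splits `⟨U n, A_h (U n)⟩` into `⟨U n, A_h V⟩`, which converges weakly, and `⟨U n, A_h (U n) -
A_h V⟩`, which tends to zero by dominated convergence on `D`. -/
theorem IsInfluenceFunction.tendsto_integral_inner_longitudinalAverage
    (hJ : IsInfluenceFunction d J)
    (hD : MeasurableSet D) (hDfin : volume D ≠ ⊤)
    (hUm : ∀ n, Measurable (U n)) (hVm : Measurable V) (hUB : ∀ n x, ‖U n x‖ ≤ B)
    (huU : ∀ n, u n =ᵐ[volume.restrict D] U n) (hvV : v =ᵐ[volume.restrict D] V)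
    (hU0 : ∀ n x, x ∉ D → U n x = 0) (hV0 : ∀ x, x ∉ D → V x = 0)
    (hweak : ∀ g, Tendsto (fun n => inner ℝ g (u n)) atTop (𝓝 (inner ℝ g v)))
    {h : ℝ} (hh : h ≠ 0) :
    Tendsto (fun n => ∫ x, inner ℝ (U n x)
        (longitudinalAverage (influenceMeasure d J) h (U n) x)) atTop
      (𝓝 (∫ x, inner ℝ (V x) (longitudinalAverage (influenceMeasure d J) h V x))) := by
  have : IsFiniteMeasure (volume.restrict D) := ⟨by simpa using hDfin.lt_top⟩
  have := hJ.isFiniteMeasure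
  set μ := influenceMeasure d J with hμ
  obtain ⟨C, hC⟩ := hJ.exists_norm_longitudinalAverage_le hDfin B hh
  have hlim : ∀ x, Tendsto (fun n => longitudinalAverage μ h (U n) x) atTop
      (𝓝 (longitudinalAverage μ h V x)) := fun x =>
    hJ.tendsto_longitudinalAverage hD hDfin huU hvV hU0 hV0 hweak hh x
  have hCU : ∀ n x, ‖longitudinalAverage μ h (U n) x‖ ≤ C := fun n x =>
    hC _ (memLp_two_of_ae_eq hD (hU0 n) (huU n)) (hU0 n) (hUB n) x
  have hCV : ∀ x, ‖longitudinalAverage μ h V x‖ ≤ C := fun x =>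
    le_of_tendsto (hlim x).norm (Eventually.of_forall fun n => hCU n x)
  have hKU : ∀ n, StronglyMeasurable (longitudinalAverage μ h (U n)) := fun n =>
    longitudinalAverage_stronglyMeasurable h (hUm n)
  have hKV : StronglyMeasurable (longitudinalAverage μ h V) :=
    longitudinalAverage_stronglyMeasurable h hVm
  have hB : 0 ≤ B := (norm_nonneg _).trans (hUB 0 0)
  have hKVL : MemLp (longitudinalAverage μ h V) 2 (volume.restrict D) :=
    MemLp.of_bound hKV.aestronglyMeasurable C (Eventually.of_forall hCV)
  have t1 := tendsto_setIntegral_inner huU hvV hweak hKVL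
  have hbound : ∀ n x,
      ‖(inner ℝ (longitudinalAverage μ h (U n) x - longitudinalAverage μ h V x) (U n x) : ℝ)‖
        ≤ ‖longitudinalAverage μ h (U n) x - longitudinalAverage μ h V x‖ * B := fun n x =>
    (norm_inner_le_norm _ _).trans (by gcongr; exact hUB n x)
  have hmeas : ∀ n, AEStronglyMeasurable (fun x =>
      (inner ℝ (longitudinalAverage μ h (U n) x - longitudinalAverage μ h V x) (U n x) : ℝ))
      (volume.restrict D) := fun n =>
    ((((hKU n).sub hKV).measurable).inner (hUm n)).aestronglyMeasurable
  have hbound2 : ∀ n x,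
      ‖(inner ℝ (longitudinalAverage μ h (U n) x - longitudinalAverage μ h V x) (U n x) : ℝ)‖
        ≤ (C + C) * B := fun n x =>
    (hbound n x).trans (by
      gcongr
      exact (norm_sub_le _ _).trans (add_le_add (hCU n x) (hCV x)))
  have t2 : Tendsto (fun n => ∫ x in D,
      (inner ℝ (longitudinalAverage μ h (U n) x - longitudinalAverage μ h V x) (U n x) : ℝ))
      atTop (𝓝 (∫ _ in D, (0 : ℝ))) := by
    refine tendsto_integral_of_dominated_convergence (fun _ => (C + C) * B) hmeas
      (integrable_const _) (fun n => Eventually.of_forall (hbound2 n))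
      (Eventually.of_forall fun x => ?_)
    refine squeeze_zero_norm (fun n => hbound n x) ?_
    have h3 := ((hlim x).sub_const (longitudinalAverage μ h V x)).norm.mul_const B
    rw [sub_self, norm_zero, zero_mul] at h3
    exact h3
  have t3 := t1.add t2
  rw [integral_zero, add_zero] at t3
  have eV : ∫ x, inner ℝ (V x) (longitudinalAverage μ h V x)
      = ∫ x in D, inner ℝ (longitudinalAverage μ h V x) (V x) := by
    rw [integral_eq_setIntegral_of_eq_zero hV0
      (fun x z => inner ℝ z (longitudinalAverage μ h V x)) (by simp)]
    simp only [real_inner_comm]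
  rw [eV]
  refine t3.congr fun n => ?_
  rw [integral_eq_setIntegral_of_eq_zero (hU0 n)
    (fun x z => inner ℝ z (longitudinalAverage μ h (U n) x)) (by simp), ← integral_add]
  · refine integral_congr_ae (Eventually.of_forall fun x => ?_)
    simp only
    rw [← inner_add_left, add_sub_cancel, real_inner_comm]
  · refine Integrable.of_bound (C := C * B)
      (hKV.measurable.inner (hUm n)).aestronglyMeasurable (Eventually.of_forall fun x => ?_)
    refine (norm_inner_le_norm _ _).trans ?_
    have := hCV x
    have := hUB n x
    gcongr
    exact (norm_nonneg _).trans (hCV x)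
  · exact Integrable.of_bound (hmeas n) _ (Eventually.of_forall (hbound2 n))

/-- Weak convergence is strong if the longitudinal variation is small at small scales. -/
theorem IsInfluenceFunction.tendsto_of_longitudinalVariation_le (hJ : IsInfluenceFunction d J)
    (hD : MeasurableSet D) (hDfin : volume D ≠ ⊤)
    (hUm : ∀ n, Measurable (U n)) (hUB : ∀ n x, ‖U n x‖ ≤ B)
    (huU : ∀ n, u n =ᵐ[volume.restrict D] U n) (hU0 : ∀ n x, x ∉ D → U n x = 0)
    (hweak : ∀ g, Tendsto (fun n => inner ℝ g (u n)) atTop (𝓝 (inner ℝ g v)))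
    (hvar : ∀ η > 0, ∃ h : ℝ, h ≠ 0 ∧ ∀ᶠ n in atTop,
      longitudinalVariation (influenceMeasure d J) (U n) h ≤ ENNReal.ofReal η) :
    Tendsto u atTop (𝓝 v) := by
  obtain ⟨c, hc0, hc⟩ := hJ.exists_integral_inner_sq_eq
  have hB : 0 ≤ B := (norm_nonneg _).trans (hUB 0 0)
  set V := D.indicator v with hV
  have hVm : Measurable V := (Lp.stronglyMeasurable v).measurable.indicator hD
  have hV0 : ∀ x, x ∉ D → V x = 0 := fun x hx => indicator_of_notMem hx _
  have hvV : v =ᵐ[volume.restrict D] V := (indicator_ae_eq_restrict hD).symm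
  refine tendsto_of_tendsto_inner_of_norm_sq_le hweak fun η hη => ?_
  -- Half of the allowance `c * η` goes to the variation term, the other half to the convergence of
  -- the quadratic form; `B + 1` avoids division by zero.
  obtain ⟨h, hh, hev⟩ := hvar (c * η / (2 * (B + 1))) (by positivity)
  have hlim := hJ.tendsto_integral_inner_longitudinalAverage hD hDfin hUm hVm hUB huU hvV hU0 hV0
    hweak hh
  have hVle := hJ.integral_inner_longitudinalAverage_le hc (memLp_two_of_ae_eq hD hV0 hvV) hh
  rw [integral_norm_sq_eq hV0 hvV] at hVle
  filter_upwards [hev, hlim.eventually (gt_mem_nhds (lt_add_of_pos_right _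
    (show 0 < c * η / 2 by positivity)))] with n h1 h2
  have h3 := hJ.mul_integral_norm_sq_le hc (hUm n) (memLp_two_of_ae_eq hD (hU0 n) (huU n)) (hUB n)
    hh (ne_top_of_le_ne_top ENNReal.ofReal_ne_top h1)
  rw [integral_norm_sq_eq (hU0 n) (huU n)] at h3
  have h4 : B * (longitudinalVariation (influenceMeasure d J) (U n) h).toReal ≤ c * η / 2 := by
    calc B * (longitudinalVariation (influenceMeasure d J) (U n) h).toReal
        ≤ (B + 1) * (c * η / (2 * (B + 1))) := by
          gcongr
          · linarith
          · exact ENNReal.toReal_le_of_le_ofReal (by positivity) h1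
      _ = c * η / 2 := by field_simp
  have h5 : c * ‖u n‖ ^ 2 ≤ c * (‖v‖ ^ 2 + η) := by linarith
  exact le_of_mul_le_mul_left h5 hc0

end Weak

/-! ### The constraint set and representatives -/

/-- The segment from `y` to `x` leaves `D`, hence meets the frontier at a point no farther from `y`
than `x` is. -/
theorem mem_constraintSet_of_mem_ball {D : Set (EuclideanSpace ℝ (Fin d))} (hD : IsOpen D)
    {α ε : ℝ} (hε : ε ≤ α) {x y : EuclideanSpace ℝ (Fin d)} (hx : x ∉ D) (hy : y ∈ D)
    (hxy : y ∈ Metric.ball x ε) : y ∈ constraintSet D α := by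
  refine ⟨hy, ?_⟩
  obtain ⟨z, hzc, hzD⟩ : ∃ z ∈ closure D ∩ segment ℝ y x, z ∉ D := by
    by_contra! hcon
    exact hx ((convex_segment y x).isPreconnected.subset_of_closure_inter_subset hD
      ⟨y, left_mem_segment ℝ y x, hy⟩ hcon (right_mem_segment ℝ y x))
  have hzf : z ∈ frontier D := by
    rw [hD.frontier_eq]
    exact ⟨hzc.1, hzD⟩
  have h1 : dist y z ≤ dist y x := by
    have := dist_add_dist_of_mem_segment hzc.2
    linarith [dist_nonneg (x := z) (y := x)]
  calc Metric.infDist y (frontier D) ≤ dist y z := Metric.infDist_le_dist_of_mem hzf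
    _ ≤ dist y x := h1
    _ < ε := hxy
    _ ≤ α := hε

theorem measurableSet_constraintSet {D : Set (EuclideanSpace ℝ (Fin d))} (hD : IsOpen D)
    (α : ℝ) : MeasurableSet (constraintSet D α) :=
  hD.measurableSet.inter (measurableSet_lt measurable_infDist measurable_const)

theorem PD_congr_ae (J f : ℝ → ℝ) {D : Set (EuclideanSpace ℝ (Fin d))} (hD : MeasurableSet D)
    (ε : ℝ) {u v : EuclideanSpace ℝ (Fin d) → EuclideanSpace ℝ (Fin d)}
    (huv : u =ᵐ[volume.restrict D] v) : PD J f D ε u = PD J f D ε v := by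
  have h : D.indicator u =ᵐ[volume] D.indicator v := by
    filter_upwards [(ae_restrict_iff' hD).1 huv] with x hx
    by_cases hxD : x ∈ D
    · rw [indicator_of_mem hxD, indicator_of_mem hxD, hx hxD]
    · rw [indicator_of_notMem hxD, indicator_of_notMem hxD]
  refine lintegral_congr_ae (ae_restrict_of_ae ?_)
  filter_upwards [h] with x hx
  unfold energyDensity
  congr 1
  refine lintegral_congr_ae (ae_restrict_of_ae ?_)
  filter_upwards [h] with y hy
  rw [strain, strain, hx, hy]

/-- Setting `u` to zero on the exceptional null sets and off `D` makes the bound and the constraint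
hold everywhere, so that translated arguments `x + h • ξ` need no almost-everywhere bookkeeping. -/
theorem exists_representative {D : Set (EuclideanSpace ℝ (Fin d))} (hD : IsOpen D) {α : ℝ}
    {u : Lp (EuclideanSpace ℝ (Fin d)) 2 (volume.restrict D)} (hu : u ∈ L2Zero D α) {B : ℝ}
    (hB0 : 0 ≤ B) (hB : ∀ᵐ x ∂(volume.restrict D), ‖u x‖ ≤ B) :
    ∃ U : EuclideanSpace ℝ (Fin d) → EuclideanSpace ℝ (Fin d), Measurable U ∧
      (∀ x, ‖U x‖ ≤ B) ∧ u =ᵐ[volume.restrict D] U ∧ (∀ x, x ∉ D → U x = 0) ∧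
      ∀ x ∈ constraintSet D α, U x = 0 := by
  have hum : Measurable u := (Lp.stronglyMeasurable u).measurable
  set S : Set (EuclideanSpace ℝ (Fin d)) := (D \ constraintSet D α) ∩ {x | ‖u x‖ ≤ B} with hS
  have hSm : MeasurableSet S :=
    (hD.measurableSet.diff (measurableSet_constraintSet hD α)).inter
      (measurableSet_le hum.norm measurable_const)
  refine ⟨S.indicator u, hum.indicator hSm, fun x => ?_, ?_, fun x hx => ?_, fun x hx => ?_⟩
  · by_cases hx : x ∈ S
    · rw [indicator_of_mem hx]
      exact hx.2
    · rw [indicator_of_notMem hx, norm_zero]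
      exact hB0
  · filter_upwards [hu, hB, ae_restrict_mem hD.measurableSet] with x h1 h2 h3
    by_cases hx : x ∈ constraintSet D α
    · rw [h1 hx, indicator_of_notMem fun h => h.1.2 hx]
    · rw [indicator_of_mem (show x ∈ S from ⟨⟨h3, hx⟩, h2⟩)]
  · exact indicator_of_notMem (fun h => hx h.1.1) _
  · exact indicator_of_notMem (fun h => h.1.2 hx) _

theorem mem_L2Zero_of_tendsto {D : Set (EuclideanSpace ℝ (Fin d))} {α : ℝ}
    {u : ℕ → Lp (EuclideanSpace ℝ (Fin d)) 2 (volume.restrict D)}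
    {v : Lp (EuclideanSpace ℝ (Fin d)) 2 (volume.restrict D)} (hu : ∀ n, u n ∈ L2Zero D α)
    (huv : Tendsto u atTop (𝓝 v)) : v ∈ L2Zero D α := by
  obtain ⟨ns, -, hns⟩ := (tendstoInMeasure_of_tendsto_Lp huv).exists_seq_tendsto_ae
  have h : ∀ᵐ x ∂(volume.restrict D), ∀ n, x ∈ constraintSet D α → u n x = 0 :=
    ae_all_iff.2 hu
  filter_upwards [hns, h] with x h1 h2 hx
  refine tendsto_nhds_unique h1 ?_
  simp only [h2 _ hx]
  exact tendsto_const_nhds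

/-- Passing from the horizon `2⁻ⁿ` to the scale `2⁻ᵐ` costs `2 ^ (n - m)`, which the factor `2⁻ⁿ` of
the energy estimate absorbs exactly. Only the energy on the right still depends on `n`. -/
theorem longitudinalVariation_half_pow_le {f J : ℝ → ℝ} (hf : IsCohesivePotential f)
    (hJ : IsInfluenceFunction d J) {D : Set (EuclideanSpace ℝ (Fin d))} (hD : IsOpen D)
    {B α : ℝ} {u : EuclideanSpace ℝ (Fin d) → EuclideanSpace ℝ (Fin d)}
    (hum : Measurable u) (hu : ∀ x, ‖u x‖ ≤ B) (hu0 : ∀ x, x ∉ D → u x = 0)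
    (huα : ∀ x ∈ constraintSet D α, u x = 0) {m n : ℕ} (hmn : m ≤ n)
    (hn : (1 / 2 : ℝ) ^ n ≤ α) :
    longitudinalVariation (influenceMeasure d J) u ((1 / 2) ^ m)
      ≤ ENNReal.ofReal ((1 / 2) ^ m) * (ENNReal.ofReal ((2 * B + 1) / f 1)
          * (volume (Metric.ball (0 : EuclideanSpace ℝ (Fin d)) 1)
            * PD J f D ((1 / 2) ^ n) u) + influenceMeasure d J univ * volume D) := by
  have hsupp : ∀ x, x ∉ D → ∀ y ∈ Metric.ball x ((1 / 2 : ℝ) ^ n), u y = 0 := by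
    intro x hx y hy
    by_cases hyD : y ∈ D
    · exact huα y (mem_constraintSet_of_mem_ball hD hn hx hyD hy)
    · exact hu0 y hyD
  have h1 := longitudinalVariation_le hf hJ hD.measurableSet (by positivity) hum hu hsupp
  have h2 : (1 / 2 : ℝ) ^ m = 2 ^ (n - m) * (1 / 2) ^ n := by
    obtain ⟨k, rfl⟩ := Nat.exists_eq_add_of_le hmn
    rw [Nat.add_sub_cancel_left, pow_add, mul_left_comm, ← mul_pow]
    norm_num
  calc longitudinalVariation (influenceMeasure d J) u ((1 / 2) ^ m)
      ≤ 2 ^ (n - m) * longitudinalVariation (influenceMeasure d J) u ((1 / 2) ^ n) := by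
        rw [h2]
        exact longitudinalVariation_two_pow_mul_le _ hum _ _
    _ ≤ 2 ^ (n - m) * _ := mul_le_mul_right h1 _
    _ = _ := by
        rw [h2, ENNReal.ofReal_mul (by positivity),
          ENNReal.ofReal_pow (zero_le_two : (0 : ℝ) ≤ 2), ENNReal.ofReal_ofNat, mul_assoc]

end CohesivePeridynamics

/-! ### The compactness theorem. -/

open CohesivePeridynamics in
theorem mainTheorem8 (d : ℕ) (hd : d = 2 ∨ d = 3)
    (f J : ℝ → ℝ) (hf : CohesivePeridynamics.IsCohesivePotential f)
    (hJ : CohesivePeridynamics.IsInfluenceFunction d J)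
    (D : Set (EuclideanSpace ℝ (Fin d))) (hD : IsOpen D) (hDb : Bornology.IsBounded D)
    (α : ℝ) (hα : 0 < α)
    (u : ℕ → Lp (EuclideanSpace ℝ (Fin d)) 2 (volume.restrict D))
    (hu : ∀ k, u k ∈ CohesivePeridynamics.L2Zero D α)
    (hbound : ⨆ k : ℕ, (CohesivePeridynamics.PD J f D (1 / ((k : ℝ) + 1)) (u k)
      + eLpNorm (u k) ⊤ (volume.restrict D)) < (⊤ : ℝ≥0∞)) :
    ∃ φ : ℕ → ℕ, StrictMono φ ∧ ∃ v ∈ CohesivePeridynamics.L2Zero D α,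
      Tendsto (fun j => u (φ j)) atTop (𝓝 v) := by
  have hDfin : volume D ≠ ⊤ := hDb.measure_lt_top.ne
  have : IsFiniteMeasure (volume.restrict D) := ⟨by simpa using hDfin.lt_top⟩
  have := hJ.isFiniteMeasure
  obtain ⟨S, hS⟩ : ∃ S : ℝ≥0∞, S = ⨆ k : ℕ, (PD J f D (1 / ((k : ℝ) + 1)) (u k)
      + eLpNorm (u k) ⊤ (volume.restrict D)) := ⟨_, rfl⟩
  rw [← hS] at hbound
  have hle : ∀ k : ℕ, PD J f D (1 / ((k : ℝ) + 1)) (u k)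
      + eLpNorm (u k) ⊤ (volume.restrict D) ≤ S := fun k => hS ▸ le_iSup (fun k : ℕ =>
        PD J f D (1 / ((k : ℝ) + 1)) (u k) + eLpNorm (u k) ⊤ (volume.restrict D)) k
  have hB : ∀ k, ∀ᵐ x ∂(volume.restrict D), ‖u k x‖ ≤ S.toReal := by
    intro k
    filter_upwards [ae_le_eLpNormEssSup (f := u k) (μ := volume.restrict D)] with x hx
    rw [← toReal_enorm]
    refine ENNReal.toReal_mono hbound.ne (hx.trans ?_)
    rw [← eLpNorm_exponent_top]
    exact le_add_self.trans (hle k)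
  choose U hUm hUB huU hU0 hUα using fun k =>
    exists_representative hD (hu k) ENNReal.toReal_nonneg (hB k)
  have : Fact ((2 : ℝ≥0∞) ≠ ⊤) := ⟨ENNReal.ofNat_ne_top⟩
  -- Index `k` carries the horizon `1 / (k + 1)`, so `k = 2 ^ n - 1` selects the dyadic horizons
  -- `2⁻ⁿ` required by the doubling argument.
  obtain ⟨φ, hφ, v, hv⟩ := exists_subseq_tendsto_inner (u := fun n => u (2 ^ n - 1))
    fun n => Lp.norm_le_of_ae_bound ENNReal.toReal_nonneg (hB (2 ^ n - 1))
  have hmono : StrictMono fun n : ℕ => 2 ^ n - 1 := by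
    refine strictMono_nat_of_lt_succ fun n => ?_
    have := Nat.one_le_two_pow (n := n)
    rw [pow_succ]
    omega
  have hPD : ∀ n : ℕ, PD J f D ((1 / 2) ^ n) (U (2 ^ n - 1)) ≤ S := by
    intro n
    rw [← PD_congr_ae J f hD.measurableSet _ (huU (2 ^ n - 1))]
    refine le_trans (le_of_eq ?_) (le_self_add.trans (hle (2 ^ n - 1)))
    congr 1
    rw [Nat.cast_sub Nat.one_le_two_pow]
    simp
  set C : ℝ≥0∞ := ENNReal.ofReal ((2 * S.toReal + 1) / f 1)
    * (volume (Metric.ball (0 : EuclideanSpace ℝ (Fin d)) 1) * S)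
    + influenceMeasure d J univ * volume D with hC
  have hCtop : C ≠ ⊤ := ENNReal.add_ne_top.2
    ⟨ENNReal.mul_ne_top ENNReal.ofReal_ne_top
      (ENNReal.mul_ne_top measure_ball_lt_top.ne hbound.ne),
    ENNReal.mul_ne_top (measure_ne_top _ _) hDfin⟩
  have hpow : Tendsto (fun n : ℕ => (1 / 2 : ℝ) ^ n) atTop (𝓝 0) :=
    tendsto_pow_atTop_nhds_zero_of_lt_one (by norm_num) (by norm_num)
  have hlim : Tendsto (fun n => u (2 ^ φ n - 1)) atTop (𝓝 v) := by
    refine hJ.tendsto_of_longitudinalVariation_le hD.measurableSet hDfin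
      (fun n => hUm (2 ^ φ n - 1)) (fun n => hUB (2 ^ φ n - 1)) (fun n => huU (2 ^ φ n - 1))
      (fun n => hU0 (2 ^ φ n - 1)) hv fun η hη => ?_
    obtain ⟨m, hm⟩ := ((hpow.mul_const C.toReal).eventually
      (gt_mem_nhds (by simpa using hη))).exists
    refine ⟨(1 / 2) ^ m, by positivity, ?_⟩
    -- The horizon must be below `α`, so that the boundary layer shields the exterior of `D`, and `m
    -- ≤ n ≤ φ n`, so that the fixed scale is not below the horizon.
    filter_upwards [(hpow.comp hφ.tendsto_atTop).eventually (gt_mem_nhds hα),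
      eventually_ge_atTop m] with n hn hmn
    refine (longitudinalVariation_half_pow_le hf hJ hD (hUm _) (hUB _) (hU0 _) (hUα _)
      (hmn.trans (hφ.id_le n)) hn.le).trans ?_
    calc _ ≤ ENNReal.ofReal ((1 / 2) ^ m) * C := by
          rw [hC]
          gcongr
          exact hPD (φ n)
      _ = ENNReal.ofReal ((1 / 2) ^ m * C.toReal) := by
          rw [ENNReal.ofReal_mul (by positivity), ENNReal.ofReal_toReal hCtop]
      _ ≤ ENNReal.ofReal η := ENNReal.ofReal_le_ofReal hm.le
  exact ⟨fun n => 2 ^ φ n - 1, hmono.comp hφ, v, mem_L2Zero_of_tendsto (fun n => hu _) hlim, hlim⟩
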